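/- **Setting.** All manifolds, metrics and vector fields are smooth ($C^\infty$). Let $(M,g_M)$ be a Riemannian manifold of dimension $4m$ with a hyperkähler structure $(I,J,K)$: smooth sections $I,J,K$ of $\mathrm{End}(TM)$ with $I^2=J^2=K^2=-\mathrm{id}$, $IJ=-JI=K$, $g_M(RX,RY)=g_M(X,Y)$, and $R$ parallel for the Levi-Civita connection $\nabla$ of $g_M$, for each $R\in\{I,J,K\}$. Let $(N,g_N)$ be a Riemannian manifold and let $F:M\to N$ be a horizontally conformal submersion with dilation $\lambda:M\to(0,\infty)$: $F$ is smooth, every differential $(F_*)_p$ is surjective, and $g_N(F_*X,F_*Y)=\lambda(p)^2 g_M(X,Y)$ for all $X,Y\in(\ker (F_*)_p)^\perp$. Assume that $(I,J,K)$ is an almost h-conformal slant basis for $F$: every point of $M$ has a neighbourhood $U$ such that, for each $R\in\{I,J,K\}$, the angle between $RV$ and the space $\ker (F_*)_q$ is the same for all $q\in U$ and all nonzero $V\in\ker (F_*)_q$. Let $\mathcal V,\mathcal H$ be the orthogonal projections of $TM$ onto $\ker F_*$ and $(\ker F_*)^\perp$. For $R\in\{I,J,K\}$, write $RV=\phi_RV+\omega_RV$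 for vertical $V$ and $RX=B_RX+C_RX$ for horizontal $X$, where $\phi_RV,B_RX$ are vertical and $\omega_RV,C_RX$ are horizontal. Let $\mathcal A_XY=\mathcal H\nabla_{\mathcal HX}\mathcal VY+\mathcal V\nabla_{\mathcal HX}\mathcal HY$, and let $\nabla^F$ be the pullback to $F^{-1}(TN)$ of the Levi-Civita connection of $g_N$. Also, $\nabla\ln\lambda$ is the gradient of $\ln\lambda$. The distribution $(\ker F_*)^\perp$ is called integrable if $[X,Y]\in\Gamma((\ker F_*)^\perp)$ for all $X,Y\in\Gamma((\ker F_*)^\perp)$. **Theorem 3.8.** The following conditions (a), (b$_I$), (b$_J$), (b$_K$) are equivalent. (a) The distribution $(\ker F_*)^\perp$ is integrable. (b$_R$) (for $R=I$, $R=J$, $R=K$ respectively) For all $X,Y\in\Gamma((\ker F_*)^\perp)$ and $V\in\Gamma(\ker F_*)$, $$\begin{aligned} &\lambda^{-2}g_N\big(\nabla^F_YF_*C_RX-\nabla^F_XF_*C_RY,\;F_*\omega_RV\big)\\ &=g_M\big(\mathcal V\nabla_XB_RY+\mathcal A_XC_RY-\mathcal V\nabla_YB_RX-\mathcal A_YC_RX,\;\phi_RV\big)\\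 &\quad+g_M\big(\mathcal A_XB_RY-\mathcal A_YB_RX-X(\ln\lambda)C_RY+Y(\ln\lambda)C_RX-(C_RY)(\ln\lambda)X\\ &\qquad\qquad+(C_RX)(\ln\lambda)Y+2g_M(X,C_RY)\nabla\ln\lambda,\;\omega_RV\big). \end{aligned}$$ -/

import Mathlib

open Bundle Manifold ContDiff

noncomputable section

namespace HConformalSlant

section Connection

variable
  {E : Type*} [NormedAddCommGroup E] [NormedSpace ℝ E] [FiniteDimensional ℝ E]
  {H : Type*} [TopologicalSpace H] (I : ModelWithCorners ℝ E H)
  {M : Type*} [TopologicalSpace M] [ChartedSpace H M] [IsManifold I ∞ M]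
  [RiemannianBundle (fun x : M ↦ TangentSpace I x)]
  {E' : Type*} [NormedAddCommGroup E'] [NormedSpace ℝ E'] [FiniteDimensional ℝ E']
  {H' : Type*} [TopologicalSpace H'] (I' : ModelWithCorners ℝ E' H')
  {N : Type*} [TopologicalSpace N] [ChartedSpace H' N] [IsManifold I' ∞ N]
  [RiemannianBundle (fun x : N ↦ TangentSpace I' x)]

instance (p : M) : FiniteDimensional ℝ (TangentSpace I p) :=
  inferInstanceAs (FiniteDimensional ℝ E)

instance (p : M) : CompleteSpace (TangentSpace I p) :=
  FiniteDimensional.complete ℝ (TangentSpace I p)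

/-- The coordinate isomorphism `T_q M → E` (for `q` near `p`) given by the chart at `p`. -/
def coordAt (p q : M) : TangentSpace I q →L[ℝ] E :=
  (trivializationAt E (TangentSpace I) p).continuousLinearMapAt ℝ q

/-- The coordinate isomorphism `E → T_q M` (for `q` near `p`) given by the chart at `p`:
`frameAt I p q v` is the value at `q` of the vector field with constant coordinates `v`. -/
def frameAt (p q : M) : E →L[ℝ] TangentSpace I q :=
  (trivializationAt E (TangentSpace I) p).symmL ℝ q

/-- The metric in the chart at `p`: `(g_{ij}(q))` as a bilinear form on the coordinate space. -/
def localMetric (p q : M) : E →L[ℝ] E →L[ℝ] ℝ :=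
  (innerSL ℝ : TangentSpace I q →L[ℝ] TangentSpace I q →L[ℝ] ℝ).bilinearComp
    (frameAt I p q) (frameAt I p q)

/-- The derivative at `p` of the coefficients of the metric in the chart at `p`. -/
def dMetric (p : M) : TangentSpace I p →L[ℝ] E →L[ℝ] E →L[ℝ] ℝ :=
  mvfderiv I (localMetric I p) p

/-- The Christoffel symbols of the first kind at `p` in the chart at `p`, as a linear form in `z`:
`½ (∂_v g(w, z) + ∂_w g(v, z) - ∂_z g(v, w))`. -/
def christoffelForm (p : M) (v w : TangentSpace I p) : TangentSpace I p →L[ℝ] ℝ :=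
  (1 / 2 : ℝ) • ((dMetric I p v (coordAt I p p w)).comp (coordAt I p p)
    + (dMetric I p w (coordAt I p p v)).comp (coordAt I p p)
    - ((dMetric I p).flip (coordAt I p p v)).flip (coordAt I p p w))

/-- The Christoffel symbols (of the second kind) of the metric at `p` in the chart at `p`:
`Γ_p(v, w)` is the tangent vector `∑ Γ^k_{ij} v^i w^j ∂_k`. -/
def christoffel (p : M) (v w : TangentSpace I p) : TangentSpace I p :=
  (InnerProductSpace.toDual ℝ (TangentSpace I p)).symm (christoffelForm I p v w)

/-- The pullback connection `∇^F` on `F⁻¹(TN)` induced by the Levi-Civita connection of the metric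
of `N`: for a vector field `S` along `F` and `v ∈ T_p M`,
`(∇^F_v S)^k = v(S^k) + Γ^k_{ij}(F p) (F_* v)^i S^j` in the chart of `N` at `F p`. -/
def pullbackConn (F : M → N) (S : ∀ q : M, TangentSpace I' (F q)) (p : M)
    (v : TangentSpace I p) : TangentSpace I' (F p) :=
  frameAt I' (F p) (F p) (mvfderiv I (fun q ↦ coordAt I' (F p) (F q) (S q)) p v)
    + christoffel I' (F p) (mfderiv I I' F p v) (S p)

/-- The Levi-Civita connection, `(∇_X Y)(p)`, as the pullback connection along the identity:
`(∇_X Y)^k = X(Y^k) + Γ^k_{ij} X^i Y^j` in the chart at `p`. -/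
def nabla (X Y : ∀ q : M, TangentSpace I q) (p : M) : TangentSpace I p :=
  pullbackConn I I (id : M → M) Y p (X p)

/-- `R` is parallel with respect to the Levi-Civita connection:
`∇_X (R Y) = R (∇_X Y)` for all smooth vector fields `X`, `Y`. -/
def IsParallel (R : ∀ p : M, TangentSpace I p →L[ℝ] TangentSpace I p) : Prop :=
  ∀ X Y : ∀ p : M, TangentSpace I p,
    ContMDiff I I.tangent ∞ (fun p ↦ (⟨p, X p⟩ : TangentBundle I M)) →
    ContMDiff I I.tangent ∞ (fun p ↦ (⟨p, Y p⟩ : TangentBundle I M)) →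
    ∀ p, nabla I X (fun q ↦ R q (Y q)) p = R p (nabla I X Y p)

/-- `(Φ, Ψ, Ω)` (usually denoted `(I, J, K)`) together with the metric of `M` is a hyperkähler
structure: three global smooth sections of `End(TM)` satisfying the quaternion relations, each
compatible with the metric and parallel with respect to its Levi-Civita connection. -/
structure IsHyperkahler (Φ Ψ Ω : ∀ p : M, TangentSpace I p →L[ℝ] TangentSpace I p) : Prop where
  smooth : ∀ R ∈ ({Φ, Ψ, Ω} : Set (∀ p : M, TangentSpace I p →L[ℝ] TangentSpace I p)),
    ContMDiff I (I.prod 𝓘(ℝ, E →L[ℝ] E)) ∞ (fun p ↦ TotalSpace.mk' (E →L[ℝ] E)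
      (E := fun p : M ↦ TangentSpace I p →L[ℝ] TangentSpace I p) p (R p))
  sq : ∀ R ∈ ({Φ, Ψ, Ω} : Set (∀ p : M, TangentSpace I p →L[ℝ] TangentSpace I p)),
    ∀ p (v : TangentSpace I p), R p (R p v) = -v
  mul : ∀ p (v : TangentSpace I p), Φ p (Ψ p v) = Ω p v
  mul_swap : ∀ p (v : TangentSpace I p), Ψ p (Φ p v) = -Ω p v
  hermitian : ∀ R ∈ ({Φ, Ψ, Ω} : Set (∀ p : M, TangentSpace I p →L[ℝ] TangentSpace I p)),
    ∀ p (v w : TangentSpace I p), inner ℝ (R p v) (R p w) = inner ℝ v w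
  parallel : ∀ R ∈ ({Φ, Ψ, Ω} : Set (∀ p : M, TangentSpace I p →L[ℝ] TangentSpace I p)),
    IsParallel I R

/-- `X ∈ Γ(D)`: a smooth vector field with values in the distribution `D`. -/
def IsSection (D : ∀ p : M, Submodule ℝ (TangentSpace I p)) (X : ∀ p : M, TangentSpace I p) :
    Prop :=
  ContMDiff I I.tangent ∞ (fun p ↦ (⟨p, X p⟩ : TangentBundle I M)) ∧ ∀ p, X p ∈ D p

/-- The distribution `D` is integrable: `[X, Y] ∈ Γ(D)` for all `X, Y ∈ Γ(D)`
(the bracket of smooth vector fields is smooth). -/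
def IsIntegrable (D : ∀ p : M, Submodule ℝ (TangentSpace I p)) : Prop :=
  ∀ X Y : ∀ p : M, TangentSpace I p, IsSection I D X → IsSection I D Y →
    ∀ p, VectorField.mlieBracket I X Y p ∈ D p

/-- The vertical distribution `ker F_*`. -/
def vertical (F : M → N) (p : M) : Submodule ℝ (TangentSpace I p) :=
  (mfderiv I I' F p).toLinearMap.ker

/-- The horizontal distribution `(ker F_*)^⊥`. -/
def horizontal (F : M → N) (p : M) : Submodule ℝ (TangentSpace I p) :=
  (vertical I I' F p)ᗮ

/-- The vertical projection `𝒱`. -/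
def projV (F : M → N) (p : M) : TangentSpace I p →L[ℝ] TangentSpace I p :=
  (vertical I I' F p).starProjection

/-- The horizontal projection `ℋ`. -/
def projH (F : M → N) (p : M) : TangentSpace I p →L[ℝ] TangentSpace I p :=
  (horizontal I I' F p).starProjection

/-- `F` is a horizontally conformal submersion with dilation `lam`. -/
structure IsHorizontallyConformalSubmersion (F : M → N) (lam : M → ℝ) : Prop where
  smooth : ContMDiff I I' ∞ F
  surjective : ∀ p, Function.Surjective (mfderiv I I' F p)
  dilation_pos : ∀ p, 0 < lam p
  conformal : ∀ p, ∀ X ∈ horizontal I I' F p, ∀ Y ∈ horizontal I I' F p,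
    inner ℝ (mfderiv I I' F p X) (mfderiv I I' F p Y) = lam p ^ 2 * inner ℝ X Y

/-- The angle between a nonzero vector `v` and a subspace `W`, i.e. the angle between `v` and its
orthogonal projection to `W` (it is `π / 2` if `v ⟂ W`). -/
def angleTo {p : M} (v : TangentSpace I p) (W : Submodule ℝ (TangentSpace I p)) : ℝ :=
  InnerProductGeometry.angle v (W.starProjection v)

/-- `(Φ, Ψ, Ω)`, a quaternionic Hermitian basis on `M`, is an almost h-conformal slant basis for
`F`: every point has a neighbourhood `U` such that for each `R ∈ {Φ, Ψ, Ω}` the angle between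
`R v` and `ker (F_*)_q` is the same for all `q ∈ U` and all nonzero `v ∈ ker (F_*)_q`. -/
def IsAlmostSlantBasis (F : M → N)
    (Φ Ψ Ω : ∀ p : M, TangentSpace I p →L[ℝ] TangentSpace I p) : Prop :=
  ∀ p : M, ∃ U : Set M, IsOpen U ∧ p ∈ U ∧
    ∀ R ∈ ({Φ, Ψ, Ω} : Set (∀ p : M, TangentSpace I p →L[ℝ] TangentSpace I p)),
      ∃ θ : ℝ, ∀ q ∈ U, ∀ v ∈ vertical I I' F q, v ≠ 0 →
        angleTo I (R q v) (vertical I I' F q) = θ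

/-- O'Neill's tensor `𝒜_X Y = ℋ ∇_{ℋX} 𝒱Y + 𝒱 ∇_{ℋX} ℋY`. -/
def oneillA (F : M → N) (X Y : ∀ q : M, TangentSpace I q) (p : M) : TangentSpace I p :=
  projH I I' F p
      (nabla I (fun q ↦ projH I I' F q (X q)) (fun q ↦ projV I I' F q (Y q)) p)
    + projV I I' F p
      (nabla I (fun q ↦ projH I I' F q (X q)) (fun q ↦ projH I I' F q (Y q)) p)

/-- `φ_R V`, the vertical part of `R V`, for `V` vertical. -/
def phi (F : M → N) (R : ∀ p : M, TangentSpace I p →L[ℝ] TangentSpace I p)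
    (V : ∀ p : M, TangentSpace I p) (p : M) : TangentSpace I p :=
  projV I I' F p (R p (V p))

/-- `ω_R V`, the horizontal part of `R V`, for `V` vertical. -/
def omega (F : M → N) (R : ∀ p : M, TangentSpace I p →L[ℝ] TangentSpace I p)
    (V : ∀ p : M, TangentSpace I p) (p : M) : TangentSpace I p :=
  projH I I' F p (R p (V p))

/-- `B_R X`, the vertical part of `R X`, for `X` horizontal. -/
def opB (F : M → N) (R : ∀ p : M, TangentSpace I p →L[ℝ] TangentSpace I p)
    (X : ∀ p : M, TangentSpace I p) (p : M) : TangentSpace I p :=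
  projV I I' F p (R p (X p))

/-- `C_R X`, the horizontal part of `R X`, for `X` horizontal. -/
def opC (F : M → N) (R : ∀ p : M, TangentSpace I p →L[ℝ] TangentSpace I p)
    (X : ∀ p : M, TangentSpace I p) (p : M) : TangentSpace I p :=
  projH I I' F p (R p (X p))

/-- `F_* X`, a vector field along `F`. -/
def push (F : M → N) (X : ∀ p : M, TangentSpace I p) (p : M) : TangentSpace I' (F p) :=
  mfderiv I I' F p (X p)

/-- `v(ln λ)` for `v ∈ T_p M`. -/
def dlog (lam : M → ℝ) (p : M) : TangentSpace I p →L[ℝ] ℝ :=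
  mvfderiv I (fun q ↦ Real.log (lam q)) p

/-- The gradient `∇ ln λ`. -/
def gradLog (lam : M → ℝ) (p : M) : TangentSpace I p :=
  (InnerProductSpace.toDual ℝ (TangentSpace I p)).symm (dlog I lam p)

/-- The identity, for all horizontal `X`, `Y` and vertical `V`,
`λ⁻² g_N(∇^F_Y F_* C_R X - ∇^F_X F_* C_R Y, F_* ω_R V)
  = g_M(𝒱∇_X B_R Y + 𝒜_X C_R Y - 𝒱∇_Y B_R X - 𝒜_Y C_R X, φ_R V)
  + g_M(𝒜_X B_R Y - 𝒜_Y B_R X - X(ln λ) C_R Y + Y(ln λ) C_R X - (C_R Y)(ln λ) X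
      + (C_R X)(ln λ) Y + 2 g_M(X, C_R Y) ∇ ln λ, ω_R V)`. -/
def SlantIdentity (F : M → N) (lam : M → ℝ)
    (R : ∀ p : M, TangentSpace I p →L[ℝ] TangentSpace I p) : Prop :=
  ∀ X Y V : ∀ p : M, TangentSpace I p,
    IsSection I (horizontal I I' F) X → IsSection I (horizontal I I' F) Y →
    IsSection I (vertical I I' F) V → ∀ p : M,
    (lam p ^ 2)⁻¹ * inner ℝ
        (pullbackConn I I' F (push I I' F (opC I I' F R X)) p (Y p)
          - pullbackConn I I' F (push I I' F (opC I I' F R Y)) p (X p))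
        (push I I' F (omega I I' F R V) p)
      = inner ℝ
          (projV I I' F p (nabla I X (opB I I' F R Y) p)
            + oneillA I I' F X (opC I I' F R Y) p
            - projV I I' F p (nabla I Y (opB I I' F R X) p)
            - oneillA I I' F Y (opC I I' F R X) p)
          (phi I I' F R V p)
        + inner ℝ
          (oneillA I I' F X (opB I I' F R Y) p - oneillA I I' F Y (opB I I' F R X) p
            - dlog I lam p (X p) • opC I I' F R Y p + dlog I lam p (Y p) • opC I I' F R X p
            - dlog I lam p (opC I I' F R Y p) • X p + dlog I lam p (opC I I' F R X p) • Y p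
            + (2 * inner ℝ (X p) (opC I I' F R Y p)) • gradLog I lam p)
          (omega I I' F R V p)

end Connection
end HConformalSlant
end

set_option linter.unusedSectionVars false

noncomputable section

namespace HConformalSlant

open scoped Topology

variable
  {E : Type*} [NormedAddCommGroup E] [NormedSpace ℝ E] [FiniteDimensional ℝ E]
  {H : Type*} [TopologicalSpace H] {I : ModelWithCorners ℝ E H} [I.Boundaryless]
  {M : Type*} [TopologicalSpace M] [ChartedSpace H M] [IsManifold I ∞ M]
  [RiemannianBundle (fun x : M ↦ TangentSpace I x)]
  {E' : Type*} [NormedAddCommGroup E'] [NormedSpace ℝ E'] [FiniteDimensional ℝ E']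
  {H' : Type*} [TopologicalSpace H'] {I' : ModelWithCorners ℝ E' H'} [I'.Boundaryless]
  {N : Type*} [TopologicalSpace N] [ChartedSpace H' N] [IsManifold I' ∞ N]
  [RiemannianBundle (fun x : N ↦ TangentSpace I' x)]

lemma one_add_one_le_infty : (1 : WithTop ℕ∞) + 1 ≤ ∞ := by
  rw [one_add_one_eq_two]
  exact ENat.LEInfty.out

lemma coordAt_eq_mfderiv {p q : M} (hq : q ∈ (chartAt H p).source) :
    coordAt I p q = mvfderiv I (extChartAt I p) q := by
  exact TangentBundle.continuousLinearMapAt_trivializationAt hq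

lemma frameAt_coordAt {p q : M} (hq : q ∈ (chartAt H p).source) (v : TangentSpace I q) :
    frameAt I p q (coordAt I p q v) = v :=
  (trivializationAt E (TangentSpace I) p).symmL_continuousLinearMapAt (R := ℝ) hq v

lemma coordAt_frameAt {p q : M} (hq : q ∈ (chartAt H p).source) (v : E) :
    coordAt I p q (frameAt I p q v) = v :=
  (trivializationAt E (TangentSpace I) p).continuousLinearMapAt_symmL (R := ℝ) hq v

variable (I I') in
/-- `S` is a vector field along `F`, smooth at `p`. -/
def SmoothAlongAt (F : M → N)
    (S : ∀ q : M, TangentSpace I' (F q)) (p : M) : Prop :=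
  ContMDiffAt I I'.tangent ∞ (fun q ↦ (⟨F q, S q⟩ : TangentBundle I' N)) p

lemma smoothAlongAt_iff {F : M → N} {S : ∀ q : M, TangentSpace I' (F q)} {p : M} :
    SmoothAlongAt I I' F S p ↔ ContMDiffAt I I' ∞ F p ∧
      ContMDiffAt I 𝓘(ℝ, E') ∞ (fun q ↦ coordAt I' (F p) (F q) (S q)) p := by
  rw [SmoothAlongAt, contMDiffAt_totalSpace]
  refine and_congr_right fun hF ↦ ?_
  refine Filter.EventuallyEq.contMDiffAt_iff ?_
  filter_upwards [hF.continuousAt.preimage_mem_nhds (chart_source_mem_nhds H' (F p))] with q hq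
  exact ((trivializationAt E' (TangentSpace I') (F p)).coe_linearMapAt_of_mem (R := ℝ)
    (b := F q) hq ▸ rfl)

/-- The directional derivative, read in a chart. -/
lemma mvfderiv_chart_symm {V : Type*} [NormedAddCommGroup V] [NormedSpace ℝ V] {f : M → V}
    {p : M} {e : E} (he : e ∈ (extChartAt I p).target)
    (hf : MDifferentiableAt I 𝓘(ℝ, V) f ((extChartAt I p).symm e))
    (X : ∀ q : M, TangentSpace I q) :
    mvfderiv I f ((extChartAt I p).symm e) (X ((extChartAt I p).symm e))
      = fderiv ℝ (f ∘ (extChartAt I p).symm) e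
        (VectorField.mpullbackWithin 𝓘(ℝ, E) I (extChartAt I p).symm X (Set.range I) e) := by
  have hs : MDifferentiableAt 𝓘(ℝ, E) I (extChartAt I p).symm e := by
    have := mdifferentiableWithinAt_extChartAt_symm he
    rwa [I.range_eq_univ, mdifferentiableWithinAt_univ] at this
  have hinv := isInvertible_mfderivWithin_extChartAt_symm he
  rw [VectorField.mpullbackWithin_apply]
  have h1 := mfderiv_comp e hf hs
  rw [mfderiv_eq_fderiv] at h1
  rw [h1, I.range_eq_univ, mfderivWithin_univ]
  rw [I.range_eq_univ, mfderivWithin_univ] at hinv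
  obtain ⟨L, hL⟩ := hinv
  rw [← hL, ContinuousLinearMap.inverse_equiv]
  exact congrArg (mfderiv I 𝓘(ℝ, V) f _) (L.apply_symm_apply _).symm

omit [FiniteDimensional ℝ E] in
lemma fderiv_fderiv_sub_fderiv_fderiv {V : Type*} [NormedAddCommGroup V] [NormedSpace ℝ V]
    {f : E → V} {X Y : E → E} {x : E} (hf : ContDiffAt ℝ ∞ f x) (hX : DifferentiableAt ℝ X x)
    (hY : DifferentiableAt ℝ Y x) :
    fderiv ℝ (fun e ↦ fderiv ℝ f e (Y e)) x (X x) - fderiv ℝ (fun e ↦ fderiv ℝ f e (X e)) x (Y x)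
      = fderiv ℝ f x (fderiv ℝ Y x (X x) - fderiv ℝ X x (Y x)) := by
  have hf2 : DifferentiableAt ℝ (fderiv ℝ f) x :=
    (hf.fderiv_right (m := 1) one_add_one_le_infty).differentiableAt one_ne_zero
  have hsnd : IsSymmSndFDerivAt ℝ f x := hf.isSymmSndFDerivAt (by simp; exact ENat.LEInfty.out)
  rw [fderiv_clm_apply hf2 hY, fderiv_clm_apply hf2 hX]
  simp [hsnd.eq (X x) (Y x)]

lemma mvfderiv_mlieBracket {V : Type*} [NormedAddCommGroup V] [NormedSpace ℝ V] {f : M → V} {p : M}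
    {X Y : ∀ q : M, TangentSpace I q} (hf : ContMDiffAt I 𝓘(ℝ, V) ∞ f p)
    (hX : SmoothAlongAt I I id X p) (hY : SmoothAlongAt I I id Y p)
    (hfX : MDifferentiableAt I 𝓘(ℝ, V) (fun q ↦ mvfderiv I f q (X q)) p)
    (hfY : MDifferentiableAt I 𝓘(ℝ, V) (fun q ↦ mvfderiv I f q (Y q)) p) :
    mvfderiv I (fun q ↦ mvfderiv I f q (Y q)) p (X p)
      - mvfderiv I (fun q ↦ mvfderiv I f q (X q)) p (Y p)
      = mvfderiv I f p (VectorField.mlieBracket I X Y p) := by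
  have he : extChartAt I p p ∈ (extChartAt I p).target := mem_extChartAt_target p
  have hsymm : (extChartAt I p).symm (extChartAt I p p) = p := extChartAt_to_inv p
  have key : ∀ (g : M → V) (Z : ∀ q : M, TangentSpace I q), MDifferentiableAt I 𝓘(ℝ, V) g p →
      mvfderiv I g p (Z p) = fderiv ℝ (g ∘ (extChartAt I p).symm) (extChartAt I p p)
        (VectorField.mpullbackWithin 𝓘(ℝ, E) I (extChartAt I p).symm Z (Set.range I)
          (extChartAt I p p)) := fun g Z hg ↦ by
    have := mvfderiv_chart_symm (f := g) he (by rwa [hsymm]) Z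
    rwa [hsymm] at this
  have hnear : ∀ᶠ e in 𝓝 (extChartAt I p p), e ∈ (extChartAt I p).target ∧
      MDifferentiableAt I 𝓘(ℝ, V) f ((extChartAt I p).symm e) := by
    refine Filter.Eventually.and (extChartAt_target_mem_nhds p) ?_
    have h1 : ∀ᶠ q in 𝓝 p, ContMDiffAt I 𝓘(ℝ, V) 1 f q :=
      (contMDiffAt_iff_contMDiffAt_nhds (by simp)).1 (hf.of_le ENat.LEInfty.out)
    have h2 := (continuousAt_extChartAt_symm (I := I) p).eventually (by rwa [hsymm])
    exact h2.mono fun e h ↦ h.mdifferentiableAt one_ne_zero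
  have hcoord : ∀ Z : ∀ q : M, TangentSpace I q,
      (fun q ↦ mvfderiv I f q (Z q)) ∘ (extChartAt I p).symm =ᶠ[𝓝 (extChartAt I p p)]
        fun e ↦ fderiv ℝ (f ∘ (extChartAt I p).symm) e
          (VectorField.mpullbackWithin 𝓘(ℝ, E) I (extChartAt I p).symm Z (Set.range I) e) :=
    fun Z ↦ hnear.mono fun e h ↦ mvfderiv_chart_symm h.1 h.2 Z
  have hdiff : ∀ Z : ∀ q : M, TangentSpace I q, SmoothAlongAt I I id Z p →
      DifferentiableAt ℝ (VectorField.mpullbackWithin 𝓘(ℝ, E) I (extChartAt I p).symm Z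
        (Set.range I) : E → E) (extChartAt I p p) := fun Z hZ ↦ by
    have h1 : ContMDiffAt I I.tangent 1 (fun q ↦ (⟨q, Z q⟩ : TangentBundle I M)) p :=
      ContMDiffAt.of_le hZ (by simp)
    have h := VectorField.contMDiffWithinAt_mpullbackWithin_extChartAt_symm (n := ∞)
      (contMDiffWithinAt_univ.2 h1) uniqueMDiffOn_univ (Set.mem_univ p) one_add_one_le_infty
    rw [Set.preimage_univ, Set.inter_univ] at h
    exact ((contMDiffAt_vectorSpace_iff_contDiffAt.1
      (h.contMDiffAt (extChartAt_target_mem_nhds p))).differentiableAt one_ne_zero)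
  have hfs : ContDiffAt ℝ ∞ (f ∘ (extChartAt I p).symm) (extChartAt I p p) := by
    have h := (contMDiffAt_iff.1 hf).2
    rwa [I.range_eq_univ, contDiffWithinAt_univ] at h
  rw [key _ X hfY, key _ Y hfX, (hcoord X).fderiv_eq, (hcoord Y).fderiv_eq]
  have hb : VectorField.mlieBracket I X Y p = VectorField.lieBracket ℝ
      (VectorField.mpullbackWithin 𝓘(ℝ, E) I (extChartAt I p).symm X (Set.range I))
      (VectorField.mpullbackWithin 𝓘(ℝ, E) I (extChartAt I p).symm Y (Set.range I))
      (extChartAt I p p) := by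
    rw [← VectorField.mlieBracketWithin_univ, VectorField.mlieBracketWithin_apply,
      mfderiv_extChartAt_self, Set.preimage_univ, Set.univ_inter]
    nth_rewrite 3 [I.range_eq_univ]
    exact (congrArg (fun T : E →L[ℝ] E ↦ T _) ContinuousLinearMap.inverse_id).trans
      (congrFun VectorField.lieBracketWithin_univ _)
  rw [hb, (hf.mdifferentiableAt (by simp)).mvfderiv, I.range_eq_univ, fderivWithin_univ]
  exact fderiv_fderiv_sub_fderiv_fderiv hfs (I.range_eq_univ ▸ hdiff X hX)
    (I.range_eq_univ ▸ hdiff Y hY)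

lemma localMetric_apply (p q : M) (v w : E) :
    localMetric I p q v w = inner ℝ (frameAt I p q v) (frameAt I p q w) := rfl

lemma contMDiffAt_localMetric [IsContMDiffRiemannianBundle I ∞ E (fun x : M ↦ TangentSpace I x)]
    (p : M) : ContMDiffAt I 𝓘(ℝ, E →L[ℝ] E →L[ℝ] ℝ) ∞ (localMetric I p) p := by
  obtain ⟨g, hg, hg'⟩ := IsContMDiffRiemannianBundle.exists_contMDiff
    (IB := I) (n := ∞) (F := E) (E := fun x : M ↦ TangentSpace I x)
  refine ((contMDiffAt_section p).1 (hg p)).congr_of_eventuallyEq ?_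
  filter_upwards [chart_source_mem_nhds H p] with q hq
  have hmem : q ∈ (trivializationAt (E →L[ℝ] ℝ)
      (fun x : M ↦ TangentSpace I x →L[ℝ] ℝ) p).baseSet := by
    rw [hom_trivializationAt_baseSet]
    exact ⟨hq, Set.mem_univ q⟩
  ext v w
  rw [localMetric_apply, hg', hom_trivializationAt_apply]
  simp only [ContinuousLinearMap.inCoordinates, ContinuousLinearMap.comp_apply,
    Trivialization.continuousLinearMapAt_apply]
  rw [Trivialization.coe_linearMapAt_of_mem _ hmem]
  beta_reduce
  rw [hom_trivializationAt_apply]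
  simp [ContinuousLinearMap.inCoordinates]
  rfl

lemma mvfderiv_congr {V : Type*} [NormedAddCommGroup V] [NormedSpace ℝ V] {f g : M → V}
    {p : M} (h : f =ᶠ[𝓝 p] g) : mvfderiv I f p = mvfderiv I g p :=
  h.mfderiv_eq (I := I) (I' := 𝓘(ℝ, V))

lemma mvfderiv_eq_fderiv {V : Type*} [NormedAddCommGroup V] [NormedSpace ℝ V] {f : M → V}
    {p : M} (hf : MDifferentiableAt I 𝓘(ℝ, V) f p) :
    mvfderiv I f p = fderiv ℝ (f ∘ (extChartAt I p).symm) (extChartAt I p p) := by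
  rw [hf.mvfderiv, I.range_eq_univ, fderivWithin_univ]
  rfl

lemma differentiableAt_comp_symm {V : Type*} [NormedAddCommGroup V] [NormedSpace ℝ V] {f : M → V}
    {p : M} (hf : MDifferentiableAt I 𝓘(ℝ, V) f p) :
    DifferentiableAt ℝ (f ∘ (extChartAt I p).symm) (extChartAt I p p) := by
  have h := (mdifferentiableAt_iff _ _).1 hf
  have h2 := h.2
  rwa [I.range_eq_univ, differentiableWithinAt_univ] at h2

lemma mvfderiv_clm_apply {V W : Type*} [NormedAddCommGroup V] [NormedSpace ℝ V]
    [NormedAddCommGroup W] [NormedSpace ℝ W] {c : M → V →L[ℝ] W} {f : M → V} {p : M}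
    (hc : MDifferentiableAt I 𝓘(ℝ, V →L[ℝ] W) c p) (hf : MDifferentiableAt I 𝓘(ℝ, V) f p)
    (v : TangentSpace I p) :
    mvfderiv I (fun q ↦ c q (f q)) p v = c p (mvfderiv I f p v) + mvfderiv I c p v (f p) := by
  have h := fderiv_clm_apply (differentiableAt_comp_symm hc) (differentiableAt_comp_symm hf)
  rw [mvfderiv_eq_fderiv hf, mvfderiv_eq_fderiv hc, mvfderiv_eq_fderiv (hc.clm_apply hf)]
  refine (congrArg (fun T : E →L[ℝ] W ↦ T v) h).trans ?_
  have key : ∀ e : E, ((c ∘ (extChartAt I p).symm) (extChartAt I p p)).comp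
        (fderiv ℝ (f ∘ (extChartAt I p).symm) (extChartAt I p p)) e
        + (fderiv ℝ (c ∘ (extChartAt I p).symm) (extChartAt I p p)).flip
          ((f ∘ (extChartAt I p).symm) (extChartAt I p p)) e
      = c p (fderiv ℝ (f ∘ (extChartAt I p).symm) (extChartAt I p p) e)
        + fderiv ℝ (c ∘ (extChartAt I p).symm) (extChartAt I p p) e (f p) := fun e ↦ by
    simp only [ContinuousLinearMap.comp_apply, ContinuousLinearMap.flip_apply,
      Function.comp_apply, extChartAt_to_inv]
  exact key v

lemma dMetric_apply [IsContMDiffRiemannianBundle I ∞ E (fun x : M ↦ TangentSpace I x)]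
    (p : M) (u : TangentSpace I p) (v w : E) :
    dMetric I p u v w = mvfderiv I (fun q ↦ localMetric I p q v w) p u := by
  have h : MDifferentiableAt I 𝓘(ℝ, E →L[ℝ] E →L[ℝ] ℝ) (localMetric I p) p :=
    (contMDiffAt_localMetric p).mdifferentiableAt (by simp)
  have hc : ∀ v : E, MDifferentiableAt I 𝓘(ℝ, E) (fun _ : M ↦ v) p :=
    fun v ↦ mdifferentiableAt_const
  rw [mvfderiv_clm_apply (h.clm_apply (hc v)) (hc w), mvfderiv_clm_apply h (hc v)]
  simp [mvfderiv_const, dMetric]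

lemma dMetric_symm [IsContMDiffRiemannianBundle I ∞ E (fun x : M ↦ TangentSpace I x)]
    (p : M) (u : TangentSpace I p) (v w : E) : dMetric I p u v w = dMetric I p u w v := by
  simp_rw [dMetric_apply, localMetric_apply, real_inner_comm]

lemma inner_christoffel (p : M) (u v w : TangentSpace I p) :
    inner ℝ (christoffel I p u v) w =
      (1 / 2 : ℝ) * (dMetric I p u (coordAt I p p v) (coordAt I p p w)
        + dMetric I p v (coordAt I p p u) (coordAt I p p w)
        - dMetric I p w (coordAt I p p u) (coordAt I p p v)) := by
  rw [christoffel, InnerProductSpace.toDual_symm_apply]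
  rfl

lemma inner_christoffel_add [IsContMDiffRiemannianBundle I ∞ E (fun x : M ↦ TangentSpace I x)]
    (p : M) (u v w : TangentSpace I p) :
    inner ℝ (christoffel I p u v) w + inner ℝ (christoffel I p u w) v =
      dMetric I p u (coordAt I p p v) (coordAt I p p w) := by
  rw [inner_christoffel, inner_christoffel, dMetric_symm p v (coordAt I p p u),
    dMetric_symm p w (coordAt I p p u), dMetric_symm p u (coordAt I p p w)]
  ring

lemma christoffel_symm [IsContMDiffRiemannianBundle I ∞ E (fun x : M ↦ TangentSpace I x)]
    (p : M) (u v : TangentSpace I p) : christoffel I p u v = christoffel I p v u := by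
  refine ext_inner_right ℝ fun w ↦ ?_
  rw [inner_christoffel, inner_christoffel, dMetric_symm p w (coordAt I p p u)]
  ring

lemma inner_pullbackConn (F : M → N) (S : ∀ q : M, TangentSpace I' (F q)) (p : M)
    (v : TangentSpace I p) (w : TangentSpace I' (F p)) :
    inner ℝ (pullbackConn I I' F S p v) w =
      localMetric I' (F p) (F p) (mvfderiv I (fun q ↦ coordAt I' (F p) (F q) (S q)) p v)
          (coordAt I' (F p) (F p) w)
        + inner ℝ (christoffel I' (F p) (mfderiv I I' F p v) (S p)) w := by
  rw [pullbackConn, inner_add_left, localMetric_apply,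
    frameAt_coordAt (mem_chart_source H' (F p))]

lemma SmoothAlongAt.mdifferentiableAt_coord {F : M → N} {S : ∀ q : M, TangentSpace I' (F q)}
    {p : M} (hS : SmoothAlongAt I I' F S p) :
    MDifferentiableAt I 𝓘(ℝ, E') (fun q ↦ coordAt I' (F p) (F q) (S q)) p :=
  (smoothAlongAt_iff.1 hS).2.mdifferentiableAt (by simp)

set_option synthInstance.maxHeartbeats 200000 in
/-- The pullback connection is compatible with the metric. -/
lemma mvfderiv_inner [IsContMDiffRiemannianBundle I' ∞ E' (fun x : N ↦ TangentSpace I' x)]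
    {F : M → N} {S T : ∀ q : M, TangentSpace I' (F q)} {p : M}
    (hS : SmoothAlongAt I I' F S p) (hT : SmoothAlongAt I I' F T p) (v : TangentSpace I p) :
    mvfderiv I (fun q ↦ inner ℝ (S q) (T q)) p v =
      inner ℝ (pullbackConn I I' F S p v) (T p) + inner ℝ (S p) (pullbackConn I I' F T p v) := by
  have hF := (smoothAlongAt_iff.1 hS).1
  have hFd : MDifferentiableAt I I' F p := hF.mdifferentiableAt (by simp)
  have hg : MDifferentiableAt I' 𝓘(ℝ, E' →L[ℝ] E' →L[ℝ] ℝ) (localMetric I' (F p)) (F p) :=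
    (contMDiffAt_localMetric (F p)).mdifferentiableAt (by simp)
  have hB : MDifferentiableAt I 𝓘(ℝ, E' →L[ℝ] E' →L[ℝ] ℝ)
      (fun q ↦ localMetric I' (F p) (F q)) p := hg.comp p hFd
  have hdB : mvfderiv I (fun q ↦ localMetric I' (F p) (F q)) p v =
      dMetric I' (F p) (mfderiv I I' F p v) :=
    congrArg (fun T : E →L[ℝ] E' →L[ℝ] E' →L[ℝ] ℝ ↦ T v) (mfderiv_comp p hg hFd)
  have hs := hS.mdifferentiableAt_coord
  have ht := hT.mdifferentiableAt_coord
  have hloc : (fun q ↦ inner ℝ (S q) (T q)) =ᶠ[𝓝 p] fun q ↦ localMetric I' (F p) (F q)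
      (coordAt I' (F p) (F q) (S q)) (coordAt I' (F p) (F q) (T q)) := by
    filter_upwards [hF.continuousAt.preimage_mem_nhds (chart_source_mem_nhds H' (F p))] with q hq
    rw [localMetric_apply, frameAt_coordAt hq, frameAt_coordAt hq]
  rw [mvfderiv_congr hloc, mvfderiv_clm_apply (hB.clm_apply hs) ht, mvfderiv_clm_apply hB hs, hdB,
    inner_pullbackConn, real_inner_comm _ (S p), inner_pullbackConn]
  have h := inner_christoffel_add (F p) (mfderiv I I' F p v) (S p) (T p)
  have hsymm : ∀ a b : E', localMetric I' (F p) (F p) a b = localMetric I' (F p) (F p) b a :=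
    fun a b ↦ by rw [localMetric_apply, localMetric_apply, real_inner_comm]
  rw [hsymm (coordAt I' (F p) (F p) (S p)), add_apply, ← h]
  ring

section LinearAlgebra

variable {V W : Type*} [NormedAddCommGroup V] [NormedSpace ℝ V] [FiniteDimensional ℝ V]
  [NormedAddCommGroup W] [NormedSpace ℝ W] [FiniteDimensional ℝ W]

lemma isInvertible_of_injective {T : V →L[ℝ] W} (hT : Function.Injective T)
    (hVW : Module.finrank ℝ V = Module.finrank ℝ W) : T.IsInvertible :=
  ⟨(LinearEquiv.ofInjectiveOfFinrankEq T.toLinearMap hT hVW).toContinuousLinearEquiv, by ext; rfl⟩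

variable (V) in
lemma finrank_clm_dual : Module.finrank ℝ (V →L[ℝ] ℝ) = Module.finrank ℝ V := by
  rw [← Subspace.dual_finrank_eq (K := ℝ) (V := V)]
  exact (LinearMap.toContinuousLinearMap (𝕜 := ℝ) (E := V) (F' := ℝ)).finrank_eq.symm

/-- The adjoint of `A` with respect to the bilinear form `G`, with values on covectors. -/
def gramAdjoint (G : V →L[ℝ] V →L[ℝ] ℝ) (A : V →L[ℝ] W) : (W →L[ℝ] ℝ) →L[ℝ] V :=
  G.inverse.comp ((ContinuousLinearMap.compL ℝ V W ℝ).flip A)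

/-- The projection onto the `G`-orthogonal complement of the kernel of `A`. -/
def gramProj (G : V →L[ℝ] V →L[ℝ] ℝ) (A : V →L[ℝ] W) : V →L[ℝ] V :=
  (gramAdjoint G A).comp ((A.comp (gramAdjoint G A)).inverse.comp A)

variable {G : V →L[ℝ] V →L[ℝ] ℝ} {A : V →L[ℝ] W}

lemma isInvertible_gram (hG : ∀ v, G v v = 0 → v = 0) : G.IsInvertible := by
  refine isInvertible_of_injective ((injective_iff_map_eq_zero G).2 fun v hv ↦ hG v ?_)
    (finrank_clm_dual V).symm
  rw [hv]
  rfl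

lemma gram_gramAdjoint (hG : ∀ v, G v v = 0 → v = 0) (φ : W →L[ℝ] ℝ) :
    G (gramAdjoint G A φ) = φ.comp A := by
  obtain ⟨e, rfl⟩ := isInvertible_gram hG
  simp only [gramAdjoint, ContinuousLinearMap.inverse_equiv]
  exact e.apply_symm_apply _

lemma isInvertible_comp_gramAdjoint (hG : ∀ v, G v v = 0 → v = 0) (hA : Function.Surjective A) :
    (A.comp (gramAdjoint G A)).IsInvertible := by
  refine isInvertible_of_injective ((injective_iff_map_eq_zero _).2 fun φ hφ ↦ ?_)
    (finrank_clm_dual W)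
  have h0 : gramAdjoint G A φ = 0 := hG _ <| by
    rw [gram_gramAdjoint hG, ContinuousLinearMap.comp_apply]
    exact (congrArg φ hφ).trans (map_zero φ)
  have h1 := gram_gramAdjoint (A := A) hG φ
  rw [h0, map_zero] at h1
  ext w
  obtain ⟨v, rfl⟩ := hA w
  exact (congrArg (fun T : V →L[ℝ] ℝ ↦ T v) h1).symm

lemma apply_gramProj (hG : ∀ v, G v v = 0 → v = 0) (hA : Function.Surjective A) (v : V) :
    A (gramProj G A v) = A v := by
  obtain ⟨e, he⟩ := isInvertible_comp_gramAdjoint hG hA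
  simp only [gramProj, ← he, ContinuousLinearMap.inverse_equiv]
  exact (congrArg (fun T : (W →L[ℝ] ℝ) →L[ℝ] W ↦ T (e.symm (A v))) he).symm.trans
    (e.apply_symm_apply _)

lemma gram_gramProj (hG : ∀ v, G v v = 0 → v = 0) (v : V) {w : V} (hw : A w = 0) :
    G (gramProj G A v) w = 0 := by
  simp only [gramProj, ContinuousLinearMap.comp_apply]
  rw [gram_gramAdjoint hG, ContinuousLinearMap.comp_apply, hw, map_zero]

set_option synthInstance.maxHeartbeats 200000 in
set_option maxHeartbeats 1000000 in
lemma contDiffAt_gramProj (hG : ∀ v, G v v = 0 → v = 0) (hA : Function.Surjective A) :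
    ContDiffAt ℝ ∞ (fun p : (V →L[ℝ] V →L[ℝ] ℝ) × (V →L[ℝ] W) ↦ gramProj p.1 p.2) (G, A) := by
  have hinv : ContDiffAt ℝ ∞ (ContinuousLinearMap.inverse : (V →L[ℝ] V →L[ℝ] ℝ) → _) G := by
    obtain ⟨e, rfl⟩ := isInvertible_gram hG
    exact contDiffAt_map_inverse e
  have hflip : ContDiff ℝ ∞ (fun B : V →L[ℝ] W ↦ (ContinuousLinearMap.compL ℝ V W ℝ).flip B) :=
    by fun_prop
  have hinv₁ : ContDiffAt ℝ ∞ (fun p : (V →L[ℝ] V →L[ℝ] ℝ) × (V →L[ℝ] W) ↦ p.1.inverse) (G, A) :=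
    ContDiffAt.comp (G, A) (f := Prod.fst) (g := ContinuousLinearMap.inverse) hinv contDiffAt_fst
  have hflip₁ : ContDiffAt ℝ ∞ (fun p : (V →L[ℝ] V →L[ℝ] ℝ) × (V →L[ℝ] W) ↦
      (ContinuousLinearMap.compL ℝ V W ℝ).flip p.2) (G, A) :=
    ContDiffAt.comp (G, A) (f := Prod.snd) hflip.contDiffAt contDiffAt_snd
  have hadj : ContDiffAt ℝ ∞
      (fun p : (V →L[ℝ] V →L[ℝ] ℝ) × (V →L[ℝ] W) ↦ gramAdjoint p.1 p.2) (G, A) :=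
    hinv₁.clm_comp hflip₁
  have hcomp : ContDiffAt ℝ ∞ (fun p : (V →L[ℝ] V →L[ℝ] ℝ) × (V →L[ℝ] W) ↦
      p.2.comp (gramAdjoint p.1 p.2)) (G, A) := contDiffAt_snd.clm_comp hadj
  have hinv' : ContDiffAt ℝ ∞ (ContinuousLinearMap.inverse : ((W →L[ℝ] ℝ) →L[ℝ] W) → _)
      (A.comp (gramAdjoint G A)) := by
    obtain ⟨e, he⟩ := isInvertible_comp_gramAdjoint hG hA
    rw [← he]
    exact contDiffAt_map_inverse e
  have hinv₂ : ContDiffAt ℝ ∞ (fun p : (V →L[ℝ] V →L[ℝ] ℝ) × (V →L[ℝ] W) ↦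
      (p.2.comp (gramAdjoint p.1 p.2)).inverse) (G, A) :=
    ContDiffAt.comp (G, A)
      (f := fun p : (V →L[ℝ] V →L[ℝ] ℝ) × (V →L[ℝ] W) ↦ p.2.comp (gramAdjoint p.1 p.2))
      (g := ContinuousLinearMap.inverse) hinv' hcomp
  exact hadj.clm_comp (hinv₂.clm_comp contDiffAt_snd)

end LinearAlgebra

lemma smoothAlongAt_push {F : M → N} (hF : ContMDiff I I' ∞ F) {X : ∀ q : M, TangentSpace I q}
    {p : M} (hX : SmoothAlongAt I I id X p) : SmoothAlongAt I I' F (push I I' F X) p :=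
  ContMDiffAt.comp p (hF.contMDiff_tangentMap (m := ∞) le_rfl).contMDiffAt hX

lemma coordAt_push_eventuallyEq {F : M → N} (hF : ContMDiff I I' ∞ F) (p : M)
    (X : ∀ q : M, TangentSpace I q) :
    (fun q ↦ coordAt I' (F p) (F q) (push I I' F X q)) =ᶠ[𝓝 p]
      fun q ↦ mvfderiv I (extChartAt I' (F p) ∘ F) q (X q) := by
  filter_upwards [hF.continuous.continuousAt.preimage_mem_nhds
    (chart_source_mem_nhds H' (F p))] with q hq
  rw [coordAt_eq_mfderiv hq]
  exact (congrArg (fun T : E →L[ℝ] E' ↦ T (X q)) (mfderiv_comp q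
    (mdifferentiableAt_extChartAt hq) (hF.mdifferentiableAt (by simp)))).symm

/-- The pullback connection is torsion-free along `F`. -/
lemma pullbackConn_push_sub [IsContMDiffRiemannianBundle I' ∞ E' (fun x : N ↦ TangentSpace I' x)]
    {F : M → N} (hF : ContMDiff I I' ∞ F) {p : M} {X Y : ∀ q : M, TangentSpace I q}
    (hX : SmoothAlongAt I I id X p) (hY : SmoothAlongAt I I id Y p) :
    pullbackConn I I' F (push I I' F Y) p (X p) - pullbackConn I I' F (push I I' F X) p (Y p)
      = mfderiv I I' F p (VectorField.mlieBracket I X Y p) := by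
  have hf : ContMDiffAt I 𝓘(ℝ, E') ∞ (extChartAt I' (F p) ∘ F) p :=
    contMDiffAt_extChartAt.comp p hF.contMDiffAt
  have hpush : ∀ {Z : ∀ q : M, TangentSpace I q}, SmoothAlongAt I I id Z p →
      MDifferentiableAt I 𝓘(ℝ, E') (fun q ↦ mvfderiv I (extChartAt I' (F p) ∘ F) q (Z q)) p :=
    fun hZ ↦ (smoothAlongAt_push hF hZ).mdifferentiableAt_coord.congr_of_eventuallyEq
      (coordAt_push_eventuallyEq hF p _).symm
  have h := mvfderiv_mlieBracket hf hX hY (hpush hX) (hpush hY)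
  rw [← mvfderiv_congr (coordAt_push_eventuallyEq hF p X),
    ← mvfderiv_congr (coordAt_push_eventuallyEq hF p Y),
    ← (coordAt_push_eventuallyEq hF p _).eq_of_nhds] at h
  have h2 := congrArg (frameAt I' (F p) (F p)) h
  rw [frameAt_coordAt (mem_chart_source H' (F p)), map_sub] at h2
  rw [pullbackConn, pullbackConn, push, push, christoffel_symm (F p) (mfderiv I I' F p (X p)),
    add_sub_add_right_eq_sub]
  exact h2

variable (I I') in
/-- The differential of `F`, read in the charts at `p` and `F p`. -/
def localDeriv (F : M → N) (p q : M) : E →L[ℝ] E' :=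
  (coordAt I' (F p) (F q)).comp ((mfderiv I I' F q).comp (frameAt I p q))

lemma contMDiffAt_localDeriv {F : M → N} (hF : ContMDiff I I' ∞ F) (p : M) :
    ContMDiffAt I 𝓘(ℝ, E →L[ℝ] E') ∞ (localDeriv I I' F p) p :=
  ContMDiffAt.mfderiv_const (m := ∞) hF.contMDiffAt le_rfl

lemma localDeriv_apply (F : M → N) {p q : M} (hq : q ∈ (chartAt H p).source)
    (v : TangentSpace I q) : localDeriv I I' F p q (coordAt I p q v) =
      coordAt I' (F p) (F q) (mfderiv I I' F q v) := by
  simp only [localDeriv, ContinuousLinearMap.comp_apply]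
  rw [frameAt_coordAt hq]

lemma localMetric_definite {p q : M} (hq : q ∈ (chartAt H p).source) (v : E)
    (hv : localMetric I p q v v = 0) : v = 0 := by
  rw [localMetric_apply, inner_self_eq_zero] at hv
  rw [← coordAt_frameAt (I := I) hq v, hv, map_zero]

lemma localDeriv_surjective {F : M → N} {p q : M} (hq : q ∈ (chartAt H p).source)
    (hFq : F q ∈ (chartAt H' (F p)).source)
    (hsurj : Function.Surjective (mfderiv I I' F q)) :
    Function.Surjective (localDeriv I I' F p q) := fun w ↦ by
  obtain ⟨v, hv⟩ := hsurj (frameAt I' (F p) (F q) w)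
  exact ⟨coordAt I p q v, by rw [localDeriv_apply F hq, hv, coordAt_frameAt hFq]⟩

lemma coordAt_projH {F : M → N} {p q : M} (hq : q ∈ (chartAt H p).source)
    (hFq : F q ∈ (chartAt H' (F p)).source)
    (hsurj : Function.Surjective (mfderiv I I' F q)) (v : TangentSpace I q) :
    coordAt I p q (projH I I' F q v) =
      gramProj (localMetric I p q) (localDeriv I I' F p q) (coordAt I p q v) := by
  have hG := localMetric_definite (I := I) hq
  have hA := localDeriv_surjective hq hFq hsurj
  set w := gramProj (localMetric I p q) (localDeriv I I' F p q) (coordAt I p q v) with hw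
  suffices h : projH I I' F q v = frameAt I p q w by rw [h, coordAt_frameAt hq]
  refine Submodule.eq_starProjection_of_mem_of_inner_eq_zero
    (K := horizontal I I' F q) ?_ ?_
  · refine (Submodule.mem_orthogonal' _ _).2 fun u hu ↦ ?_
    have hu₀ : mfderiv I I' F q u = 0 := hu
    have hu' : localDeriv I I' F p q (coordAt I p q u) = 0 := by
      rw [localDeriv_apply F hq, hu₀, map_zero]
    have := gram_gramProj hG (coordAt I p q v) hu'
    rwa [localMetric_apply, frameAt_coordAt hq] at this
  · intro u hu
    refine (Submodule.mem_orthogonal _ _).1 hu _ (LinearMap.mem_ker.2 ?_)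
    change mfderiv I I' F q (v - frameAt I p q w) = 0
    have h := apply_gramProj hG hA (coordAt I p q v)
    rw [← hw, ← coordAt_frameAt (I := I) hq w, localDeriv_apply F hq, localDeriv_apply F hq] at h
    have h2 := congrArg (frameAt I' (F p) (F q)) h
    rw [frameAt_coordAt hFq, frameAt_coordAt hFq] at h2
    rw [map_sub, h2, sub_self]

lemma smoothAlongAt_projH [IsContMDiffRiemannianBundle I ∞ E (fun x : M ↦ TangentSpace I x)]
    {F : M → N} (hF : ContMDiff I I' ∞ F) (hsurj : ∀ q, Function.Surjective (mfderiv I I' F q))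
    {p : M} {X : ∀ q : M, TangentSpace I q} (hX : SmoothAlongAt I I id X p) :
    SmoothAlongAt I I id (fun q ↦ projH I I' F q (X q)) p := by
  refine smoothAlongAt_iff.2 ⟨contMDiffAt_id, ?_⟩
  have hp := mem_chart_source H p
  have hFp := mem_chart_source H' (F p)
  have hproj : ContMDiffAt I 𝓘(ℝ, E →L[ℝ] E) ∞
      (fun q ↦ gramProj (localMetric I p q) (localDeriv I I' F p q)) p :=
    ContDiffAt.comp_contMDiffAt
      (g := fun T : (E →L[ℝ] E →L[ℝ] ℝ) × (E →L[ℝ] E') ↦ gramProj T.1 T.2)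
      (f := fun q ↦ (localMetric I p q, localDeriv I I' F p q))
      (contDiffAt_gramProj (localMetric_definite hp) (localDeriv_surjective hp hFp (hsurj p)))
      ((contMDiffAt_localMetric p).prodMk_space (contMDiffAt_localDeriv hF p))
  refine (hproj.clm_apply (smoothAlongAt_iff.1 hX).2).congr_of_eventuallyEq ?_
  filter_upwards [chart_source_mem_nhds H p, hF.continuous.continuousAt.preimage_mem_nhds
    (chart_source_mem_nhds H' (F p))] with q hq hFq
  exact coordAt_projH hq hFq (hsurj q) (X q)

lemma projV_eq_sub (F : M → N) (p : M) (v : TangentSpace I p) :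
    projV I I' F p v = v - projH I I' F p v := by
  rw [eq_sub_iff_add_eq]
  exact Submodule.starProjection_add_starProjection_orthogonal v

lemma SmoothAlongAt.sub {F : M → N} {S T : ∀ q : M, TangentSpace I' (F q)} {p : M}
    (hS : SmoothAlongAt I I' F S p) (hT : SmoothAlongAt I I' F T p) :
    SmoothAlongAt I I' F (fun q ↦ S q - T q) p := by
  rw [smoothAlongAt_iff] at *
  simp only [map_sub]
  exact ⟨hS.1, hS.2.sub hT.2⟩

lemma smoothAlongAt_projV [IsContMDiffRiemannianBundle I ∞ E (fun x : M ↦ TangentSpace I x)]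
    {F : M → N} (hF : ContMDiff I I' ∞ F) (hsurj : ∀ q, Function.Surjective (mfderiv I I' F q))
    {p : M} {X : ∀ q : M, TangentSpace I q} (hX : SmoothAlongAt I I id X p) :
    SmoothAlongAt I I id (fun q ↦ projV I I' F q (X q)) p := by
  simp only [projV_eq_sub]
  exact hX.sub (smoothAlongAt_projH hF hsurj hX)

set_option synthInstance.maxHeartbeats 200000 in
lemma pullbackConn_sub {F : M → N} {S T : ∀ q : M, TangentSpace I' (F q)} {p : M}
    (hS : SmoothAlongAt I I' F S p) (hT : SmoothAlongAt I I' F T p) (v : TangentSpace I p) :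
    pullbackConn I I' F (fun q ↦ S q - T q) p v =
      pullbackConn I I' F S p v - pullbackConn I I' F T p v := by
  refine ext_inner_right ℝ fun w ↦ ?_
  have h : mvfderiv I (fun q ↦ coordAt I' (F p) (F q) (S q - T q)) p =
      mvfderiv I (fun q ↦ coordAt I' (F p) (F q) (S q)) p
        - mvfderiv I (fun q ↦ coordAt I' (F p) (F q) (T q)) p := by
    simp only [map_sub]
    exact mvfderiv_sub hS.mdifferentiableAt_coord hT.mdifferentiableAt_coord
  rw [inner_sub_left]
  simp only [inner_pullbackConn, h, inner_christoffel]
  simp only [map_sub, sub_apply]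
  ring

lemma smoothAlongAt_frameAt (p : M) (v : E) : SmoothAlongAt I I id (fun q ↦ frameAt I p q v) p := by
  refine smoothAlongAt_iff.2 ⟨contMDiffAt_id, ?_⟩
  refine (contMDiffAt_const (c := v)).congr_of_eventuallyEq ?_
  filter_upwards [chart_source_mem_nhds H p] with q hq
  exact coordAt_frameAt hq v

lemma SmoothAlongAt.inner [IsContMDiffRiemannianBundle I' ∞ E' (fun x : N ↦ TangentSpace I' x)]
    {F : M → N} {S T : ∀ q : M, TangentSpace I' (F q)} {p : M}
    (hS : SmoothAlongAt I I' F S p) (hT : SmoothAlongAt I I' F T p) :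
    ContMDiffAt I 𝓘(ℝ, ℝ) ∞ (fun q ↦ inner ℝ (S q) (T q)) p :=
  ContMDiffAt.inner_bundle (F := E') (E := fun x : N ↦ TangentSpace I' x) (b := F) hS hT

lemma nabla_sub_nabla [IsContMDiffRiemannianBundle I ∞ E (fun x : M ↦ TangentSpace I x)]
    {X Y : ∀ q : M, TangentSpace I q} {p : M} (hX : SmoothAlongAt I I id X p)
    (hY : SmoothAlongAt I I id Y p) :
    nabla I X Y p - nabla I Y X p = VectorField.mlieBracket I X Y p := by
  have hpush : ∀ Z : ∀ q : M, TangentSpace I q, push I I id Z = Z := fun Z ↦ by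
    funext q
    rw [push, mfderiv_id]
    rfl
  have h := pullbackConn_push_sub (contMDiff_id (I := I) (M := M) (n := ∞)) hX hY
  rw [hpush, hpush, mfderiv_id] at h
  exact h

section Projections

variable {F : M → N} {p : M}

lemma projV_mem (v : TangentSpace I p) : projV I I' F p v ∈ vertical I I' F p :=
  Submodule.starProjection_apply_mem _ v

lemma projH_mem (v : TangentSpace I p) : projH I I' F p v ∈ horizontal I I' F p :=
  Submodule.starProjection_apply_mem _ v

lemma projV_add_projH (v : TangentSpace I p) : projV I I' F p v + projH I I' F p v = v :=
  Submodule.starProjection_add_starProjection_orthogonal v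

lemma inner_eq_zero_of_horizontal {x v : TangentSpace I p} (hx : x ∈ horizontal I I' F p)
    (hv : v ∈ vertical I I' F p) : inner ℝ x v = 0 :=
  (Submodule.mem_orthogonal' _ _).1 hx v hv

lemma projH_of_mem {x : TangentSpace I p} (hx : x ∈ horizontal I I' F p) :
    projH I I' F p x = x :=
  Submodule.starProjection_eq_self_iff.2 hx

lemma projV_of_mem {x : TangentSpace I p} (hx : x ∈ vertical I I' F p) :
    projV I I' F p x = x :=
  Submodule.starProjection_eq_self_iff.2 hx

lemma inner_projV {v w : TangentSpace I p} (hw : w ∈ vertical I I' F p) :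
    inner ℝ (projV I I' F p v) w = inner ℝ v w := by
  conv_rhs => rw [← projV_add_projH (F := F) (I' := I') v, inner_add_left,
    inner_eq_zero_of_horizontal (projH_mem v) hw, add_zero]

lemma inner_projH {v w : TangentSpace I p} (hw : w ∈ horizontal I I' F p) :
    inner ℝ (projH I I' F p v) w = inner ℝ v w := by
  conv_rhs => rw [← projV_add_projH (F := F) (I' := I') v, inner_add_left, real_inner_comm,
    inner_eq_zero_of_horizontal hw (projV_mem v), zero_add]

end Projections

namespace IsHorizontallyConformalSubmersion

variable [IsContMDiffRiemannianBundle I ∞ E (fun x : M ↦ TangentSpace I x)]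
  [IsContMDiffRiemannianBundle I' ∞ E' (fun x : N ↦ TangentSpace I' x)]
  {F : M → N} {lam : M → ℝ}

lemma inner_mfderiv (hF : IsHorizontallyConformalSubmersion I I' F lam) {p : M}
    (v : TangentSpace I p) {x : TangentSpace I p} (hx : x ∈ horizontal I I' F p) :
    inner ℝ (mfderiv I I' F p v) (mfderiv I I' F p x) = lam p ^ 2 * inner ℝ v x := by
  have hv : mfderiv I I' F p (projV I I' F p v) = 0 := projV_mem v
  rw [← inner_projH hx, ← hF.conformal p _ (projH_mem v) x hx]
  conv_lhs => rw [← projV_add_projH (F := F) (I' := I') v, map_add, hv, zero_add]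

lemma mdifferentiableAt_dilation (hF : IsHorizontallyConformalSubmersion I I' F lam) {p : M}
    {x : TangentSpace I p} (hx : x ∈ horizontal I I' F p) (hx₀ : x ≠ 0) :
    MDifferentiableAt I 𝓘(ℝ, ℝ) lam p := by
  let W : ∀ q : M, TangentSpace I q := fun q ↦ projH I I' F q (frameAt I p q (coordAt I p p x))
  have hW : SmoothAlongAt I I id W p :=
    smoothAlongAt_projH hF.smooth hF.surjective (smoothAlongAt_frameAt p _)
  have hWp : W p = x := by
    simp only [W]
    rw [frameAt_coordAt (mem_chart_source H p), projH_of_mem hx]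
  have hnum : ContMDiffAt I 𝓘(ℝ, ℝ) ∞
      (fun q ↦ inner ℝ (push I I' F W q) (push I I' F W q)) p :=
    (smoothAlongAt_push hF.smooth hW).inner (smoothAlongAt_push hF.smooth hW)
  have hden : ContMDiffAt I 𝓘(ℝ, ℝ) ∞ (fun q ↦ inner ℝ (W q) (W q)) p :=
    hW.inner hW
  have hden₀ : inner ℝ (W p) (W p) ≠ 0 := by
    rw [hWp]
    exact inner_self_ne_zero.2 hx₀
  have hlam : (fun q ↦ inner ℝ (push I I' F W q) (push I I' F W q) / inner ℝ (W q) (W q))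
      =ᶠ[𝓝 p] fun q ↦ lam q ^ 2 := by
    filter_upwards [hden.continuousAt.eventually_ne hden₀] with q hq
    rw [push, hF.conformal q _ (projH_mem _) _ (projH_mem _), mul_div_cancel_right₀ _ hq]
  have hsq : ContMDiffAt I 𝓘(ℝ, ℝ) ∞ (fun q ↦ lam q ^ 2) p :=
    (hnum.div₀ hden hden₀).congr_of_eventuallyEq hlam.symm
  have hsqrt : ContMDiffAt I 𝓘(ℝ, ℝ) ∞ (fun q ↦ √(lam q ^ 2)) p :=
    ContDiffAt.comp_contMDiffAt (g := Real.sqrt) (f := fun q ↦ lam q ^ 2)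
      (Real.contDiffAt_sqrt (pow_ne_zero 2 (hF.dilation_pos p).ne')) hsq
  simp only [Real.sqrt_sq (hF.dilation_pos _).le] at hsqrt
  exact hsqrt.mdifferentiableAt (by simp)

lemma mvfderiv_dilation (hF : IsHorizontallyConformalSubmersion I I' F lam) {p : M}
    (hlam : MDifferentiableAt I 𝓘(ℝ, ℝ) lam p) (v : TangentSpace I p) :
    mvfderiv I (fun q ↦ lam q ^ 2) p v = 2 * lam p ^ 2 * dlog I lam p v := by
  have h0 := (hF.dilation_pos p).ne'
  have hx : (lam ∘ (extChartAt I p).symm) (extChartAt I p p) = lam p :=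
    congrArg lam (extChartAt_to_inv p)
  have hlog : MDifferentiableAt I 𝓘(ℝ, ℝ) (fun q ↦ Real.log (lam q)) p :=
    (Real.differentiableAt_log h0).mdifferentiableAt.comp p hlam
  have hsq : MDifferentiableAt I 𝓘(ℝ, ℝ) (fun q ↦ lam q ^ 2) p :=
    (differentiableAt_pow 2).mdifferentiableAt.comp p hlam
  have h1 := fderiv.log (differentiableAt_comp_symm hlam) (by rwa [hx])
  have h2 := fderiv_fun_pow 2 (differentiableAt_comp_symm hlam)
  rw [hx] at h1 h2
  rw [dlog, mvfderiv_eq_fderiv hlog, mvfderiv_eq_fderiv hsq]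
  have key : ∀ e : E, fderiv ℝ (fun x ↦ (lam ∘ (extChartAt I p).symm) x ^ 2) (extChartAt I p p) e =
      2 * lam p ^ 2 *
        fderiv ℝ (fun x ↦ Real.log ((lam ∘ (extChartAt I p).symm) x)) (extChartAt I p p) e :=
    fun e ↦ by
      rw [h1, h2]
      simp only [smul_apply, smul_eq_mul]
      field_simp
      simp only [nsmul_eq_mul]
      ring
  exact key v

lemma inner_pullbackConn_add (hF : IsHorizontallyConformalSubmersion I I' F lam) {p : M}
    {X Y Z : ∀ q : M, TangentSpace I q}
    (hY : IsSection I (horizontal I I' F) Y) (hZ : IsSection I (horizontal I I' F) Z) :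
    inner ℝ (pullbackConn I I' F (push I I' F Y) p (X p)) (push I I' F Z p)
        + inner ℝ (pullbackConn I I' F (push I I' F Z) p (X p)) (push I I' F Y p) =
      2 * lam p ^ 2 * dlog I lam p (X p) * inner ℝ (Y p) (Z p)
        + lam p ^ 2 * (inner ℝ (nabla I X Y p) (Z p) + inner ℝ (nabla I X Z p) (Y p)) := by
  have hYs : SmoothAlongAt I I id Y p := hY.1 p
  have hZs : SmoothAlongAt I I id Z p := hZ.1 p
  by_cases hx : ∀ x ∈ horizontal I I' F p, x = 0
  · simp [push, hx _ (hY.2 p), hx _ (hZ.2 p)]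
  push Not at hx
  obtain ⟨x, hx, hx₀⟩ := hx
  have hlam := hF.mdifferentiableAt_dilation hx hx₀
  have h1 := mvfderiv_inner (smoothAlongAt_push hF.smooth hYs) (smoothAlongAt_push hF.smooth hZs)
    (X p)
  have h2 := mvfderiv_inner hYs hZs (X p)
  have hsq : MDifferentiableAt I 𝓘(ℝ, ℝ) (fun q ↦ lam q ^ 2) p :=
    (differentiableAt_pow 2).mdifferentiableAt.comp p hlam
  have hin : MDifferentiableAt I 𝓘(ℝ, ℝ) (fun q ↦ inner ℝ (Y q) (Z q)) p :=
    (hYs.inner hZs).mdifferentiableAt (by simp)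
  have h3 : (fun q ↦ inner ℝ (push I I' F Y q) (push I I' F Z q)) =
      (fun q ↦ lam q ^ 2) * fun q ↦ inner ℝ (Y q) (Z q) :=
    funext fun q ↦ hF.conformal q _ (hY.2 q) _ (hZ.2 q)
  rw [h3, mvfderiv_mul hsq hin] at h1
  simp only [add_apply, smul_apply, smul_eq_mul] at h1
  rw [hF.mvfderiv_dilation hlam, h2, real_inner_comm _ (push I I' F Y p),
    real_inner_comm _ (Y p)] at h1
  rw [nabla, nabla]
  linear_combination -h1

/-- The second fundamental form of `F` on horizontal vector fields. -/
lemma inner_pullbackConn_push (hF : IsHorizontallyConformalSubmersion I I' F lam) {p : M}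
    {X Y Z : ∀ q : M, TangentSpace I q} (hX : IsSection I (horizontal I I' F) X)
    (hY : IsSection I (horizontal I I' F) Y) (hZ : IsSection I (horizontal I I' F) Z) :
    inner ℝ (pullbackConn I I' F (push I I' F Y) p (X p)) (push I I' F Z p) =
      lam p ^ 2 * (inner ℝ (nabla I X Y p) (Z p) + dlog I lam p (X p) * inner ℝ (Y p) (Z p)
        + dlog I lam p (Y p) * inner ℝ (X p) (Z p) - dlog I lam p (Z p) * inner ℝ (X p) (Y p)) := by
  have hsymm : ∀ {X Y Z : ∀ q : M, TangentSpace I q}, IsSection I (horizontal I I' F) X →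
      IsSection I (horizontal I I' F) Y → IsSection I (horizontal I I' F) Z →
      inner ℝ (pullbackConn I I' F (push I I' F Y) p (X p)) (push I I' F Z p)
          - inner ℝ (pullbackConn I I' F (push I I' F X) p (Y p)) (push I I' F Z p) =
        lam p ^ 2 * (inner ℝ (nabla I X Y p) (Z p) - inner ℝ (nabla I Y X p) (Z p)) := by
    intro X Y Z hX hY hZ
    have hXs : SmoothAlongAt I I id X p := hX.1 p
    have hYs : SmoothAlongAt I I id Y p := hY.1 p
    rw [← inner_sub_left, ← inner_sub_left, nabla_sub_nabla hXs hYs,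
      pullbackConn_push_sub hF.smooth hXs hYs, push, hF.inner_mfderiv _ (hZ.2 p)]
  have h1 := hF.inner_pullbackConn_add (p := p) (X := X) hY hZ
  have h2 := hF.inner_pullbackConn_add (p := p) (X := Y) hX hZ
  have h3 := hF.inner_pullbackConn_add (p := p) (X := Z) hX hY
  have h4 := hsymm hX hY hZ
  have h5 := hsymm hX hZ hY
  have h6 := hsymm hY hZ hX
  linear_combination (h1 + h2 - h3 + h4 - h5 - h6) / 2

end IsHorizontallyConformalSubmersion

lemma IsSection.projH [IsContMDiffRiemannianBundle I ∞ E (fun x : M ↦ TangentSpace I x)]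
    {F : M → N} (hF : ContMDiff I I' ∞ F) (hsurj : ∀ q, Function.Surjective (mfderiv I I' F q))
    {X : ∀ q : M, TangentSpace I q} (hX : ∀ p, SmoothAlongAt I I id X p) :
    IsSection I (horizontal I I' F) (fun q ↦ HConformalSlant.projH I I' F q (X q)) :=
  ⟨fun _ ↦ smoothAlongAt_projH hF hsurj (hX _), fun _ ↦ projH_mem _⟩

lemma IsSection.projV [IsContMDiffRiemannianBundle I ∞ E (fun x : M ↦ TangentSpace I x)]
    {F : M → N} (hF : ContMDiff I I' ∞ F) (hsurj : ∀ q, Function.Surjective (mfderiv I I' F q))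
    {X : ∀ q : M, TangentSpace I q} (hX : ∀ p, SmoothAlongAt I I id X p) :
    IsSection I (vertical I I' F) (fun q ↦ HConformalSlant.projV I I' F q (X q)) :=
  ⟨fun _ ↦ smoothAlongAt_projV hF hsurj (hX _), fun _ ↦ projV_mem _⟩

lemma smoothAlongAt_endomorphism {R : ∀ p : M, TangentSpace I p →L[ℝ] TangentSpace I p}
    (hR : ContMDiff I (I.prod 𝓘(ℝ, E →L[ℝ] E)) ∞ (fun p ↦ TotalSpace.mk' (E →L[ℝ] E)
      (E := fun p : M ↦ TangentSpace I p →L[ℝ] TangentSpace I p) p (R p)))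
    {X : ∀ q : M, TangentSpace I q} {p : M} (hX : SmoothAlongAt I I id X p) :
    SmoothAlongAt I I id (fun q ↦ R q (X q)) p :=
  ContMDiffAt.clm_bundle_apply (F₁ := E) (F₂ := E) (hR p) hX

lemma smoothAlongAt_mlieBracket {X Y : ∀ q : M, TangentSpace I q} {p : M}
    (hX : SmoothAlongAt I I id X p) (hY : SmoothAlongAt I I id Y p) :
    SmoothAlongAt I I id (VectorField.mlieBracket I X Y) p := by
  have : IsManifold I ((⊤ : ℕ∞) + 1) M := by
    simpa using (inferInstance : IsManifold I ∞ M)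
  have : IsManifold I (minSmoothness ℝ 2) M := by
    simpa using (inferInstance : IsManifold I 2 M)
  exact ContMDiffAt.mlieBracket_vectorField (m := ⊤) (n := ⊤) hX hY (by simp)

lemma nabla_sub {X Y Z : ∀ q : M, TangentSpace I q} {p : M}
    (hY : SmoothAlongAt I I id Y p) (hZ : SmoothAlongAt I I id Z p) :
    nabla I X (fun q ↦ Y q - Z q) p = nabla I X Y p - nabla I X Z p :=
  pullbackConn_sub hY hZ (X p)

variable [IsContMDiffRiemannianBundle I ∞ E (fun x : M ↦ TangentSpace I x)]
  [IsContMDiffRiemannianBundle I' ∞ E' (fun x : N ↦ TangentSpace I' x)]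
  {F : M → N} {lam : M → ℝ}
  {R : ∀ p : M, TangentSpace I p →L[ℝ] TangentSpace I p}

lemma inner_oneillA_vertical {X Y : ∀ q : M, TangentSpace I q}
    (hX : ∀ q, X q ∈ horizontal I I' F q) (hY : ∀ q, Y q ∈ horizontal I I' F q) {p : M}
    {v : TangentSpace I p} (hv : v ∈ vertical I I' F p) :
    inner ℝ (oneillA I I' F X Y p) v = inner ℝ (nabla I X Y p) v := by
  rw [oneillA, inner_add_left, inner_eq_zero_of_horizontal (projH_mem _) hv, inner_projV hv,
    zero_add]
  simp only [projH_of_mem (hX _), projH_of_mem (hY _)]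

lemma inner_oneillA_horizontal {X Y : ∀ q : M, TangentSpace I q}
    (hX : ∀ q, X q ∈ horizontal I I' F q) (hY : ∀ q, Y q ∈ vertical I I' F q) {p : M}
    {x : TangentSpace I p} (hx : x ∈ horizontal I I' F p) :
    inner ℝ (oneillA I I' F X Y p) x = inner ℝ (nabla I X Y p) x := by
  rw [oneillA, inner_add_left, real_inner_comm _ (projV I I' F p _),
    inner_eq_zero_of_horizontal hx (projV_mem _), inner_projH hx, add_zero]
  simp only [projH_of_mem (hX _), projV_of_mem (hY _)]

lemma slantIdentity_iff_inner_mlieBracket (hF : IsHorizontallyConformalSubmersion I I' F lam)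
    (hRs : ContMDiff I (I.prod 𝓘(ℝ, E →L[ℝ] E)) ∞ (fun p ↦ TotalSpace.mk' (E →L[ℝ] E)
      (E := fun p : M ↦ TangentSpace I p →L[ℝ] TangentSpace I p) p (R p)))
    (hsq : ∀ p (v : TangentSpace I p), R p (R p v) = -v)
    (hherm : ∀ p (v w : TangentSpace I p), inner ℝ (R p v) (R p w) = inner ℝ v w)
    (hpar : IsParallel I R) :
    SlantIdentity I I' F lam R ↔ ∀ X Y V : ∀ p : M, TangentSpace I p,
      IsSection I (horizontal I I' F) X → IsSection I (horizontal I I' F) Y →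
      IsSection I (vertical I I' F) V → ∀ p : M,
      inner ℝ (VectorField.mlieBracket I X Y p) (V p) = 0 := by
  refine forall₃_congr fun X Y V ↦ forall₃_congr fun hX hY hV ↦ forall_congr' fun p ↦ ?_
  have hRX : ∀ q, SmoothAlongAt I I id (fun q ↦ R q (X q)) q :=
    fun q ↦ smoothAlongAt_endomorphism hRs (hX.1 q)
  have hRY : ∀ q, SmoothAlongAt I I id (fun q ↦ R q (Y q)) q :=
    fun q ↦ smoothAlongAt_endomorphism hRs (hY.1 q)
  have hRV : ∀ q, SmoothAlongAt I I id (fun q ↦ R q (V q)) q :=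
    fun q ↦ smoothAlongAt_endomorphism hRs (hV.1 q)
  have hCX : IsSection I (horizontal I I' F) (opC I I' F R X) := .projH hF.smooth hF.surjective hRX
  have hCY : IsSection I (horizontal I I' F) (opC I I' F R Y) := .projH hF.smooth hF.surjective hRY
  have hω : IsSection I (horizontal I I' F) (omega I I' F R V) :=
    .projH hF.smooth hF.surjective hRV
  have hBX : IsSection I (vertical I I' F) (opB I I' F R X) := .projV hF.smooth hF.surjective hRX
  have hBY : IsSection I (vertical I I' F) (opB I I' F R Y) := .projV hF.smooth hF.surjective hRY
  have hφ : phi I I' F R V p ∈ vertical I I' F p := projV_mem _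
  have hlam := (pow_pos (hF.dilation_pos p) 2).ne'
  have h1 := hF.inner_pullbackConn_push (p := p) hY hCX hω
  have h2 := hF.inner_pullbackConn_push (p := p) hX hCY hω
  have hskew : inner ℝ (Y p) (opC I I' F R X p) = -inner ℝ (X p) (opC I I' F R Y p) := by
    rw [real_inner_comm _ (Y p), real_inner_comm _ (X p), opC, opC, inner_projH (hY.2 p),
      inner_projH (hX.2 p), ← hherm p (R p (X p)), hsq, inner_neg_left, real_inner_comm]
  have hBCX : nabla I Y (opB I I' F R X) p =
      nabla I Y (fun q ↦ R q (X q)) p - nabla I Y (opC I I' F R X) p := by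
    rw [← nabla_sub (hRX p) (hCX.1 p)]
    exact congrArg (fun Z ↦ nabla I Y Z p) (funext fun q ↦ projV_eq_sub F q _)
  have hBCY : nabla I X (opB I I' F R Y) p =
      nabla I X (fun q ↦ R q (Y q)) p - nabla I X (opC I I' F R Y) p := by
    rw [← nabla_sub (hRY p) (hCY.1 p)]
    exact congrArg (fun Z ↦ nabla I X Z p) (funext fun q ↦ projV_eq_sub F q _)
  have hV' : R p (V p) = phi I I' F R V p + omega I I' F R V p := (projV_add_projH _).symm
  have hbr : inner ℝ (VectorField.mlieBracket I X Y p) (V p) =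
      inner ℝ (nabla I X (fun q ↦ R q (Y q)) p) (phi I I' F R V p)
        + inner ℝ (nabla I X (fun q ↦ R q (Y q)) p) (omega I I' F R V p)
        - inner ℝ (nabla I Y (fun q ↦ R q (X q)) p) (phi I I' F R V p)
        - inner ℝ (nabla I Y (fun q ↦ R q (X q)) p) (omega I I' F R V p) := by
    rw [← hherm, ← nabla_sub_nabla (hX.1 p) (hY.1 p), map_sub, ← hpar X Y hX.1 hY.1,
      ← hpar Y X hY.1 hX.1, hV', inner_sub_left, inner_add_right, inner_add_right]
    ring
  have hgrad : inner ℝ (gradLog I lam p) (omega I I' F R V p) =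
      dlog I lam p (omega I I' F R V p) := by
    rw [gradLog, InnerProductSpace.toDual_symm_apply]
  rw [inner_sub_left, h1, h2]
  simp only [inner_add_left, inner_sub_left, real_inner_smul_left, inner_projV hφ, hgrad,
    inner_oneillA_vertical hX.2 hCY.2 hφ, inner_oneillA_vertical hY.2 hCX.2 hφ,
    inner_oneillA_horizontal hX.2 hBY.2 (hω.2 p), inner_oneillA_horizontal hY.2 hBX.2 (hω.2 p),
    hBCX, hBCY, hskew]
  rw [← mul_sub, inv_mul_cancel_left₀ hlam, hbr, ← sub_eq_zero, ← neg_eq_zero]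
  refine Eq.congr_left ?_
  ring

lemma isIntegrable_iff_inner_mlieBracket (hF : IsHorizontallyConformalSubmersion I I' F lam) :
    IsIntegrable I (horizontal I I' F) ↔ ∀ X Y V : ∀ p : M, TangentSpace I p,
      IsSection I (horizontal I I' F) X → IsSection I (horizontal I I' F) Y →
      IsSection I (vertical I I' F) V → ∀ p : M,
      inner ℝ (VectorField.mlieBracket I X Y p) (V p) = 0 := by
  refine ⟨fun h X Y V hX hY hV p ↦ inner_eq_zero_of_horizontal (h X Y hX hY p) (hV.2 p),
    fun h X Y hX hY p ↦ ?_⟩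
  have hV : IsSection I (vertical I I' F)
      (fun q ↦ projV I I' F q (VectorField.mlieBracket I X Y q)) :=
    .projV hF.smooth hF.surjective fun q ↦ smoothAlongAt_mlieBracket (hX.1 q) (hY.1 q)
  have h0 := h X Y _ hX hY hV p
  rw [← inner_projV (projV_mem _), inner_self_eq_zero] at h0
  rw [← projV_add_projH (F := F) (I' := I') (VectorField.mlieBracket I X Y p), h0, zero_add]
  exact projH_mem _

lemma isIntegrable_iff_slantIdentity (hF : IsHorizontallyConformalSubmersion I I' F lam)
    {Φ Ψ Ω : ∀ p : M, TangentSpace I p →L[ℝ] TangentSpace I p} (hM : IsHyperkahler I Φ Ψ Ω)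
    (hR : R ∈ ({Φ, Ψ, Ω} : Set (∀ p : M, TangentSpace I p →L[ℝ] TangentSpace I p))) :
    IsIntegrable I (horizontal I I' F) ↔ SlantIdentity I I' F lam R :=
  (isIntegrable_iff_inner_mlieBracket hF).trans (slantIdentity_iff_inner_mlieBracket hF
    (hM.smooth R hR) (hM.sq R hR) (hM.hermitian R hR) (hM.parallel R hR)).symm

end HConformalSlant

end

open HConformalSlant in
theorem theorem3p8 (m n : ℕ)
    {M : Type*} [TopologicalSpace M] [T2Space M]
    [ChartedSpace (EuclideanSpace ℝ (Fin (4 * m))) M] [IsManifold (𝓡 (4 * m)) ∞ M]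
    [RiemannianBundle (fun x : M ↦ TangentSpace (𝓡 (4 * m)) x)]
    [IsContMDiffRiemannianBundle (𝓡 (4 * m)) ∞ (EuclideanSpace ℝ (Fin (4 * m)))
      (fun x : M ↦ TangentSpace (𝓡 (4 * m)) x)]
    {N : Type*} [TopologicalSpace N] [T2Space N]
    [ChartedSpace (EuclideanSpace ℝ (Fin n)) N] [IsManifold (𝓡 n) ∞ N]
    [RiemannianBundle (fun x : N ↦ TangentSpace (𝓡 n) x)]
    [IsContMDiffRiemannianBundle (𝓡 n) ∞ (EuclideanSpace ℝ (Fin n))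
      (fun x : N ↦ TangentSpace (𝓡 n) x)]
    (I J K : ∀ p : M, TangentSpace (𝓡 (4 * m)) p →L[ℝ] TangentSpace (𝓡 (4 * m)) p)
    (hM : IsHyperkahler (𝓡 (4 * m)) I J K)
    (F : M → N) (lam : M → ℝ)
    (hF : IsHorizontallyConformalSubmersion (𝓡 (4 * m)) (𝓡 n) F lam)
    (hS : IsAlmostSlantBasis (𝓡 (4 * m)) (𝓡 n) F I J K) :
    List.TFAE [
      IsIntegrable (𝓡 (4 * m)) (horizontal (𝓡 (4 * m)) (𝓡 n) F),
      SlantIdentity (𝓡 (4 * m)) (𝓡 n) F lam I,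
      SlantIdentity (𝓡 (4 * m)) (𝓡 n) F lam J,
      SlantIdentity (𝓡 (4 * m)) (𝓡 n) F lam K] := by
  tfae_have 1 ↔ 2 := isIntegrable_iff_slantIdentity hF hM (by simp)
  tfae_have 1 ↔ 3 := isIntegrable_iff_slantIdentity hF hM (by simp)
  tfae_have 1 ↔ 4 := isIntegrable_iff_slantIdentity hF hM (by simp)
  tfae_finish
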